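/- Let $\mathcal L:\mathbb C[z]\to\mathbb C$ be a positive-definite linear functional, i.e. $\mathcal L[p]>0$ for every polynomial $p\not\equiv 0$ with $p(x)\ge 0$ for all real $x$, and let $\{P_n\}_{n\ge 0}$ be its monic orthogonal polynomial system (OPS): $P_n$ is monic of degree $n$, $\mathcal L[P_nP_m]=0$ for $n\neq m$, and $\mathcal L[P_n^2]\ne 0$. Let $\kappa\in\mathbb C\setminus\mathbb R$, and let $\mathcal L^{-*}$ be a Geronimus transformation of $\mathcal L$ at $\kappa$, i.e. a linear functional on $\mathbb C[z]$ with $$\mathcal L^{-*}[(z-\kappa)p(z)]=\mathcal L[p(z)]\quad\text{for all } p\in\mathbb C[z]$$ (the value $s_0^*=\mathcal L^{-*}[1]\in\mathbb C$ is a free parameter). Suppose that $\mathcal L^{-*}$ has a monic OPS $\{P_n^{-*}(\kappa,z)\}_{n\ge 0}$. Suppose that $\{P_n\}$ is in the Nevai class $\mathcal N(a,c)$ for some $a\in[0,\infty)$, $c\in\mathbb R$: in the recurrence $$zP_n(z)=P_{n+1}(z)+c_{n+1}P_n(z)+\lambda_{n+1}P_{n-1}(z),\quad n\ge 1,\qquad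 P_0=1,\ P_1(z)=z-c_1,$$ one has $\lambda_n\to a$ and $c_n\to c$. Let $$f(z)=\frac{(z-c)+\sqrt{(z-c)^2-4a}}{2},$$ with the branch of the square root that is holomorphic off $[c-2\sqrt a,\,c+2\sqrt a]$ and equals $(z-c)+O(1/z)$ as $z\to\infty$. Then for every compact $K\subset\mathbb C\setminus(\mathbb R\cup\{\kappa\})$ the polynomials $P_n^{-*}(\kappa,\cdot)$ have no zeros on $K$ for all sufficiently large $n$, and $$\frac{P_n^{-*}(\kappa,z)}{P_{n-1}^{-*}(\kappa,z)}\longrightarrow f(z)\quad (n\to\infty)\quad\text{uniformly on } K.$$ -/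

import Mathlib

open Polynomial Filter Topology
open scoped ComplexOrder

/-- A linear functional on `ℂ[z]` is positive-definite if `L[p] > 0` (in particular `L[p]` is real)
for every nonzero polynomial `p` that is real and non-negative at every real point. -/
def PositiveDefiniteFunctional (L : ℂ[X] →ₗ[ℂ] ℂ) : Prop :=
  ∀ p : ℂ[X], p ≠ 0 → (∀ x : ℝ, 0 ≤ p.eval (x : ℂ)) → 0 < L p

/-- `P` is a monic orthogonal polynomial system (OPS) with respect to `L`. -/
structure IsMonicOPS (L : ℂ[X] →ₗ[ℂ] ℂ) (P : ℕ → ℂ[X]) : Prop where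
  monic : ∀ n, (P n).Monic
  natDegree_eq : ∀ n, (P n).natDegree = n
  orthogonal : ∀ n m, n ≠ m → L (P n * P m) = 0
  norm_ne_zero : ∀ n, L (P n ^ 2) ≠ 0

/-- The Christoffel transformation of `M` at `κ`: the functional `p ↦ M[(z - κ) p]`. -/
noncomputable def christoffelTransform (κ : ℂ) (M : ℂ[X] →ₗ[ℂ] ℂ) : ℂ[X] →ₗ[ℂ] ℂ :=
  M ∘ₗ LinearMap.mulLeft ℂ (X - C κ)

/-- `M` is a Geronimus transformation of `L` at `κ`: the Christoffel transformation of `M` at `κ`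
is `L`. The value `M 1` is a free parameter. -/
def IsGeronimusTransform (κ : ℂ) (L M : ℂ[X] →ₗ[ℂ] ℂ) : Prop :=
  christoffelTransform κ M = L

/-- `P` is in the Nevai class `N(a, c)`, `a ∈ [0, ∞)`, `c ∈ ℝ`: it satisfies the recurrence
`z P_n = P_{n+1} + c_{n+1} P_n + λ_{n+1} P_{n-1}` for `n ≥ 1`, with `P_0 = 1`, `P_1 = z - c_1`,
where `λ_n → a` and `c_n → c`. -/
def InNevaiClass (a c : ℝ) (P : ℕ → ℂ[X]) : Prop :=
  0 ≤ a ∧ ∃ cs lam : ℕ → ℂ,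
    P 0 = 1 ∧ P 1 = X - C (cs 1) ∧
    (∀ n, 1 ≤ n →
      X * P n = P (n + 1) + C (cs (n + 1)) * P n + C (lam (n + 1)) * P (n - 1)) ∧
    Tendsto lam atTop (𝓝 (a : ℂ)) ∧ Tendsto cs atTop (𝓝 (c : ℂ))

/-- The branch of `√((z - c)² - 4a)` that is `(z - c) + O(1/z)` at infinity. With the principal
square root, it is `w √(1 - 4a/w²)` for `w = z - c`; if `a ≥ 0`, then `1 - 4a/w²` lies on the
branch cut `(-∞, 0]` only if `w` is real, so this is holomorphic off the real line. -/
noncomputable def nevaiSqrt (a c : ℝ) (z : ℂ) : ℂ :=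
  (z - c) * (1 - 4 * a / (z - c) ^ 2) ^ (1 / 2 : ℂ)

/-- `f(z) = ((z - c) + √((z - c)² - 4a)) / 2`. -/
noncomputable def nevaiRatioLimit (a c : ℝ) (z : ℂ) : ℂ :=
  ((z - c) + nevaiSqrt a c z) / 2

/-!
Write `R n z = P_{n+1}(z) / P_n(z)`, and let `g(z) = z - c - f(z)` be the second root of
`t² - (z - c) t + a = 0`.

Positivity of `L` makes the recurrence coefficients real with `λ_n > 0`. Off the real line the
iteration `R ↦ z - c_n - λ_n / R` therefore keeps `R n z` in the half-plane
`Im z · Im R ≥ (Im z)²`, while `g(z)` lies on the other side of the real line. In the coordinate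
`(R - f) / (R - g)` the limiting iteration is multiplication by `g / f`, whose modulus is bounded
away from `1` on compact sets off the real line, and the perturbation is uniformly small; hence
`R n → f` uniformly (`tendstoUniformlyOn_ratio`).

Orthogonality gives `G_{n+1} = P_{n+1} - ρ_n P_n` with `ρ_n = r_{n+1} / r_n` and `r_n = M[P_n] ≠ 0`
(`IsGeronimusTransform.ops_eq`). The numbers `r_n` solve the recurrence of the `P_n` at `z = κ`, so
by Poincaré's theorem (`tendsto_ratio_of_recurrence`) `ρ_n` tends to one of `f(κ)`, `g(κ)`; the
second case occurs when `r_n` is the minimal solution. Since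
`(f(z) - f(κ)) (f(z) - g(κ)) = f(z) (z - κ)`, either limit stays away from `f(z)` when `z` stays
away from `κ`. Hence `G_{n+1} = P_n (R n - ρ_n)` has no zeros on `K` for large `n`, and
`G_{n+2} / G_{n+1} = R n · (R (n+1) - ρ_{n+1}) / (R n - ρ_n)` tends to `f`.
-/

/-! ### Contractive recursions -/

/-- A bounded sequence of functions that is contracted up to an error tending to zero tends to zero
uniformly. -/
lemma eventually_lt_of_forward_contraction {α : Type*} {x : ℕ → α → ℝ} {s : Set α} {q U : ℝ}
    {η : ℕ → ℝ} (hq0 : 0 ≤ q) (hq1 : q < 1) (hU : ∀ n, ∀ z ∈ s, x n z ≤ U)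
    (hx : ∀ n, ∀ z ∈ s, x (n + 1) z ≤ q * x n z + η n) (hη : Tendsto η atTop (𝓝 0))
    {ε : ℝ} (hε : 0 < ε) : ∀ᶠ n in atTop, ∀ z ∈ s, x n z < ε := by
  have h1 : ∀ᶠ n in atTop, η n < ε / 2 * (1 - q) :=
    hη.eventually_lt_const (mul_pos (half_pos hε) (sub_pos.2 hq1))
  obtain ⟨N, hN⟩ := eventually_atTop.1 h1
  have key : ∀ k, ∀ z ∈ s, x (N + k) z ≤ ε / 2 + q ^ k * |U| := by
    intro k z hz
    induction k with
    | zero => have := hU N z hz; have := le_abs_self U; simp; linarith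
    | succ k ih =>
      have h2 := hx (N + k) z hz
      have h3 := hN (N + k) (Nat.le_add_right _ _)
      have h4 := mul_le_mul_of_nonneg_left ih hq0
      rw [← add_assoc, pow_succ]
      nlinarith
  have h5 : Tendsto (fun k : ℕ => q ^ k * |U|) atTop (𝓝 0) := by
    simpa using (tendsto_pow_atTop_nhds_zero_of_lt_one hq0 hq1).mul_const |U|
  obtain ⟨k0, hk0⟩ := eventually_atTop.1 (h5.eventually_lt_const (half_pos hε))
  filter_upwards [eventually_ge_atTop (N + k0)] with n hn z hz
  obtain ⟨k, rfl⟩ := Nat.exists_eq_add_of_le (le_trans (Nat.le_add_right N k0) hn)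
  have := key k z hz
  have := hk0 k (by omega)
  linarith

/-- A bounded sequence whose terms are controlled by a contraction of the *next* term, up to an
error tending to zero, tends to zero. -/
lemma tendsto_zero_of_backward_contraction {x : ℕ → ℝ} {q U : ℝ} {η : ℕ → ℝ} (hq0 : 0 ≤ q)
    (hq1 : q < 1) (h0 : ∀ n, 0 ≤ x n) (hU : ∀ n, x n ≤ U)
    (hx : ∀ n, x n ≤ q * x (n + 1) + η n) (hη : Tendsto η atTop (𝓝 0)) :
    Tendsto x atTop (𝓝 0) := by
  refine (tendsto_order.2 ⟨fun b hb => Eventually.of_forall fun n => hb.trans_le (h0 n),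
    fun ε hε => ?_⟩)
  have h1 : ∀ᶠ n in atTop, η n < ε / 2 * (1 - q) :=
    hη.eventually_lt_const (mul_pos (half_pos hε) (sub_pos.2 hq1))
  obtain ⟨N, hN⟩ := eventually_atTop.1 h1
  have key : ∀ k, ∀ n, N ≤ n → x n ≤ ε / 2 + q ^ k * |U| := by
    intro k
    induction k with
    | zero => intro n _; have := hU n; have := le_abs_self U; simp; linarith
    | succ k ih =>
      intro n hn
      have h4 := mul_le_mul_of_nonneg_left (ih (n + 1) (by omega)) hq0
      have h2 := hx n
      have h3 := hN n hn
      rw [pow_succ]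
      nlinarith
  have h5 : Tendsto (fun k : ℕ => q ^ k * |U|) atTop (𝓝 0) := by
    simpa using (tendsto_pow_atTop_nhds_zero_of_lt_one hq0 hq1).mul_const |U|
  obtain ⟨k, hk⟩ := (h5.eventually_lt_const (half_pos hε)).exists
  filter_upwards [eventually_ge_atTop N] with n hn
  have := key k n hn
  linarith

/-- The dichotomy behind Poincaré's theorem: if `A (n + 1) ≈ F * A n` and `B (n + 1) ≈ G * B n` with
`G < F` and relative errors tending to zero, then either `A` dominates `B` or `B` dominates `A`. -/
lemma dominance_dichotomy {A B ε : ℕ → ℝ} {F G : ℝ} (hG : 0 ≤ G) (hGF : G < F)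
    (hA0 : ∀ n, 0 ≤ A n) (hB0 : ∀ n, 0 ≤ B n) (hAB : ∀ n, 0 < A n + B n)
    (hA : ∀ n, |A (n + 1) - F * A n| ≤ ε n * (A n + B n))
    (hB : ∀ n, |B (n + 1) - G * B n| ≤ ε n * (A n + B n))
    (hε : Tendsto ε atTop (𝓝 0)) :
    Tendsto (fun n => B n / A n) atTop (𝓝 0) ∧ (∀ᶠ n in atTop, 0 < A n) ∨
      Tendsto (fun n => A n / B n) atTop (𝓝 0) ∧ (∀ᶠ n in atTop, 0 < B n) := by
  have hF : 0 < F := hG.trans_lt hGF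
  have hε0 : ∀ n, 0 ≤ ε n := fun n =>
    nonneg_of_mul_nonneg_left ((abs_nonneg _).trans (hA n)) (hAB n)
  have h1 : ∀ᶠ n in atTop, ε n < (F - G) / 4 := hε.eventually_lt_const (by linarith)
  obtain ⟨N, hN⟩ := eventually_atTop.1 h1
  have hη : Tendsto (fun n => 4 * ε n / F) atTop (𝓝 0) := by
    simpa using (hε.const_mul 4).div_const F
  have hq0 : 0 ≤ G / F := div_nonneg hG hF.le
  have hq1 : G / F < 1 := (div_lt_one hF).2 hGF
  -- once `B ≤ A` at a late index, it persists, and `B / A` is contracted forwards; otherwise `A < B`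
  -- at all late indices, and `A / B` is contracted backwards
  by_cases hcase : ∃ m, N ≤ m ∧ B m ≤ A m
  · left
    obtain ⟨m, hm, hBA⟩ := hcase
    have hBAk : ∀ k, B (m + k) ≤ A (m + k) := by
      intro k
      induction k with
      | zero => exact hBA
      | succ k ih =>
        have h2 := abs_le.1 (hA (m + k))
        have h3 := abs_le.1 (hB (m + k))
        have h4 := hN (m + k) (by omega)
        have h5 := hε0 (m + k)
        have h6 := hA0 (m + k)
        rw [← add_assoc]
        nlinarith [mul_le_mul_of_nonneg_left ih hG, mul_le_mul_of_nonneg_left ih h5,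
          mul_nonneg h6 (sub_nonneg.2 h4.le)]
    have hpos : ∀ k, 0 < A (m + k) := fun k => by
      have := hAB (m + k); have := hBAk k; linarith
    have hle1 : ∀ k, B (m + k) / A (m + k) ≤ 1 := fun k => (div_le_one (hpos k)).2 (hBAk k)
    have hstep : ∀ k, B (m + (k + 1)) / A (m + (k + 1)) ≤
        G / F * (B (m + k) / A (m + k)) + 4 * ε (m + k) / F := by
      intro k
      have h2 := abs_le.1 (hA (m + k))
      have h3 := abs_le.1 (hB (m + k))
      have h5 := hε0 (m + k)
      have hb := hBAk k
      have ha := hpos k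
      have ha' := hpos (k + 1)
      have hx1 := hle1 (k + 1)
      rw [← add_assoc] at ha' hx1 ⊢
      set x' := B (m + k + 1) / A (m + k + 1) with hx'
      have hxA : x' * A (m + k + 1) = B (m + k + 1) := div_mul_cancel₀ _ ha'.ne'
      have hx0 : 0 ≤ x' := div_nonneg (hB0 _) ha'.le
      have hE : ε (m + k) * (A (m + k) + B (m + k)) ≤ 2 * ε (m + k) * A (m + k) := by
        nlinarith [mul_le_mul_of_nonneg_left hb h5]
      have hE0 : 0 ≤ ε (m + k) * (A (m + k) + B (m + k)) := mul_nonneg h5 (hAB _).le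
      have h7 : x' * (F * A (m + k)) ≤ G * B (m + k) + 4 * ε (m + k) * A (m + k) := by
        have h8 : x' * (F * A (m + k) - ε (m + k) * (A (m + k) + B (m + k))) ≤
            x' * A (m + k + 1) := mul_le_mul_of_nonneg_left (by linarith) hx0
        have h9 : x' * (ε (m + k) * (A (m + k) + B (m + k))) ≤
            1 * (ε (m + k) * (A (m + k) + B (m + k))) := mul_le_mul_of_nonneg_right hx1 hE0
        linarith
      have h10 : G / F * (B (m + k) / A (m + k)) + 4 * ε (m + k) / F =
          (G * B (m + k) + 4 * ε (m + k) * A (m + k)) / (F * A (m + k)) := by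
        field_simp
      rw [h10, le_div_iff₀ (mul_pos hF ha)]
      exact h7
    refine ⟨?_, eventually_atTop.2 ⟨m, fun n hn => ?_⟩⟩
    · rw [← tendsto_add_atTop_iff_nat m]
      refine (tendsto_order.2 ⟨fun b hb => Eventually.of_forall fun n =>
        hb.trans_le (div_nonneg (hB0 _) (hA0 _)), fun e he => ?_⟩)
      have := eventually_lt_of_forward_contraction (s := (Set.univ : Set Unit))
        (x := fun k _ => B (m + k) / A (m + k)) hq0 hq1 (fun k _ _ => hle1 k)
        (fun k _ _ => hstep k)
        (η := fun k => 4 * ε (m + k) / F)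
        (by simpa [add_comm] using (tendsto_add_atTop_iff_nat m).2 hη) he
      filter_upwards [this] with k hk
      rw [add_comm k m]
      exact hk () trivial
    · obtain ⟨k, rfl⟩ := Nat.exists_eq_add_of_le hn
      exact hpos k
  · right
    push Not at hcase
    have hBpos : ∀ n, N ≤ n → 0 < B n := fun n hn => (hA0 n).trans_lt (hcase n hn)
    refine ⟨?_, eventually_atTop.2 ⟨N, hBpos⟩⟩
    rw [← tendsto_add_atTop_iff_nat N]
    refine tendsto_zero_of_backward_contraction (U := 1) (η := fun k => 4 * ε (k + N) / F) hq0 hq1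
      (fun k => div_nonneg (hA0 _) (hB0 _))
      (fun k => (div_le_one (hBpos _ (by omega))).2 (hcase _ (by omega)).le) (fun k => ?_)
      ((tendsto_add_atTop_iff_nat N).2 hη)
    have e1 : k + 1 + N = k + N + 1 := by omega
    rw [e1]
    have h2 := abs_le.1 (hA (k + N))
    have h3 := abs_le.1 (hB (k + N))
    have h5 := hε0 (k + N)
    have hb := hcase (k + N) (by omega)
    have hp := hBpos (k + N) (by omega)
    have hp' := hBpos (k + N + 1) (by omega)
    have hx1 : A (k + N + 1) / B (k + N + 1) ≤ 1 :=
      (div_le_one hp').2 (hcase _ (by omega)).le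
    set x' := A (k + N + 1) / B (k + N + 1) with hx'
    have hxB : x' * B (k + N + 1) = A (k + N + 1) := div_mul_cancel₀ _ hp'.ne'
    have hx0 : 0 ≤ x' := div_nonneg (hA0 _) hp'.le
    have hE : ε (k + N) * (A (k + N) + B (k + N)) ≤ 2 * ε (k + N) * B (k + N) := by
      nlinarith [mul_le_mul_of_nonneg_left hb.le h5]
    have hE0 : 0 ≤ ε (k + N) * (A (k + N) + B (k + N)) := mul_nonneg h5 (hAB _).le
    have h7 : F * A (k + N) ≤ x' * (G * B (k + N)) + 4 * ε (k + N) * B (k + N) := by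
      have h8 : x' * B (k + N + 1) ≤
          x' * (G * B (k + N) + ε (k + N) * (A (k + N) + B (k + N))) :=
        mul_le_mul_of_nonneg_left (by linarith) hx0
      have h9 : x' * (ε (k + N) * (A (k + N) + B (k + N))) ≤
          1 * (ε (k + N) * (A (k + N) + B (k + N))) := mul_le_mul_of_nonneg_right hx1 hE0
      linarith
    have h10 : G / F * x' + 4 * ε (k + N) / F = (G * x' + 4 * ε (k + N)) / F := by
      field_simp
    rw [h10, div_le_div_iff₀ hp hF]
    linarith

/-! ### The characteristic roots -/

/-- The limit `f` and its conjugate root `g = z - c - f` are the two roots of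
`t² - (z - c) t + a = 0`, and `f` is the larger one, by a margin of at least `|Im z|`. -/
lemma nevaiRatioLimit_roots {a c : ℝ} (ha : 0 ≤ a) {z : ℂ} (hz : z.im ≠ 0) :
    nevaiRatioLimit a c z * (z - c - nevaiRatioLimit a c z) = a ∧
      ‖z - c - nevaiRatioLimit a c z‖ + |z.im| ≤ ‖nevaiRatioLimit a c z‖ ∧
      (z - c - nevaiRatioLimit a c z).im * z.im ≤ 0 := by
  set w : ℂ := z - c with hw
  have hwim : w.im = z.im := by simp [hw]
  have hw0 : w ≠ 0 := fun h => hz (by rw [← hwim, h]; simp)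
  set s : ℂ := (1 - 4 * a / w ^ 2) ^ (1 / 2 : ℂ) with hs
  have hss : s ^ 2 = 1 - 4 * a / w ^ 2 := by
    rw [hs, one_div]
    exact Complex.cpow_nat_inv_pow _ two_ne_zero
  have hsw : w ^ 2 * (1 - s ^ 2) = 4 * a := by
    rw [hss]; field_simp; ring
  have hf : nevaiRatioLimit a c z = w * (1 + s) / 2 := by
    simp only [nevaiRatioLimit, nevaiSqrt, ← hw, ← hs]; ring
  have hg : w - nevaiRatioLimit a c z = w * (1 - s) / 2 := by rw [hf]; ring
  have hs0 : 0 ≤ s.re := by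
    by_cases hx : 1 - 4 * a / w ^ 2 = 0
    · rw [hs, hx]; simp
    · rw [hs, Complex.cpow_def_of_ne_zero hx, Complex.exp_re]
      refine mul_nonneg (Real.exp_pos _).le (Real.cos_nonneg_of_neg_pi_div_two_le_of_le ?_ ?_)
      · have := Complex.neg_pi_lt_arg (1 - 4 * a / w ^ 2)
        simp [Complex.mul_im, Complex.log_im]; linarith
      · have := Complex.arg_le_pi (1 - 4 * a / w ^ 2)
        simp [Complex.mul_im, Complex.log_im]; linarith
  -- `s` cannot be purely imaginary: `w² (1 - s²) = 4a ≥ 0` would then force `w` to be real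
  have hspos : 0 < s.re := by
    refine lt_of_le_of_ne hs0 fun h0 => ?_
    have hre := congrArg Complex.re hsw
    have him := congrArg Complex.im hsw
    simp [pow_two, Complex.mul_re, Complex.mul_im, ← h0] at hre him
    have hτ : 0 < 1 + s.im * s.im := by nlinarith [mul_self_nonneg s.im]
    have hre0 : w.re = 0 := by
      rcases him with him | him
      · have h2 : w.re * w.im = 0 := by linarith
        exact (mul_eq_zero.1 h2).resolve_right (by rwa [hwim])
      · linarith
    rw [hre0] at hre
    have : 0 < w.im * w.im := mul_self_pos.2 (by rwa [hwim])
    nlinarith [mul_pos this hτ]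
  rw [hg, hf]
  set f : ℂ := w * (1 + s) / 2 with hfdef
  set g : ℂ := w * (1 - s) / 2 with hgdef
  have hfg : f * g = a := by
    rw [hfdef, hgdef]; linear_combination hsw / 4
  have hsum : f + g = w := by rw [hfdef, hgdef]; ring
  have hlt : ‖g‖ < ‖f‖ := by
    rw [hfdef, hgdef, norm_div, norm_div, norm_mul, norm_mul]
    have : ‖1 - s‖ < ‖1 + s‖ := by
      rw [← sq_lt_sq₀ (norm_nonneg _) (norm_nonneg _), ← Complex.normSq_eq_norm_sq,
        ← Complex.normSq_eq_norm_sq, Complex.normSq_apply, Complex.normSq_apply]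
      simp
      nlinarith
    have hw1 : 0 < ‖w‖ := norm_pos_iff.2 hw0
    gcongr
    simp
  have hf1 : 0 < ‖f‖ := (norm_nonneg g).trans_lt hlt
  have ha' : a = ‖f‖ * ‖g‖ := by
    rw [← norm_mul, hfg, Complex.norm_real, Real.norm_of_nonneg ha]
  have hfsq : ‖f‖ ^ 2 = f.re * f.re + f.im * f.im := by
    rw [← Complex.normSq_eq_norm_sq, Complex.normSq_apply]
  have hre := congrArg Complex.re hfg
  have him := congrArg Complex.im hfg
  simp only [Complex.mul_re, Complex.mul_im, Complex.ofReal_re, Complex.ofReal_im] at hre him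
  have hgim : g.im * ‖f‖ ^ 2 = -a * f.im := by
    rw [hfsq]; linear_combination f.re * him - f.im * hre
  have hgim' : g.im * ‖f‖ = -‖g‖ * f.im := by
    have : ‖f‖ * (g.im * ‖f‖) = ‖f‖ * (-‖g‖ * f.im) := by rw [ha'] at hgim; linarith
    exact mul_left_cancel₀ hf1.ne' this
  have hwf : z.im * ‖f‖ = f.im * (‖f‖ - ‖g‖) := by
    rw [← hwim, ← hsum, Complex.add_im]; linarith
  refine ⟨hfg, ?_, ?_⟩
  · have h1 : |z.im| * ‖f‖ ≤ (‖f‖ - ‖g‖) * ‖f‖ := by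
      calc |z.im| * ‖f‖ = |f.im| * (‖f‖ - ‖g‖) := by
            rw [← abs_of_pos hf1, ← abs_mul, hwf, abs_mul, abs_of_pos hf1,
              abs_of_pos (sub_pos.2 hlt)]
        _ ≤ ‖f‖ * (‖f‖ - ‖g‖) :=
            mul_le_mul_of_nonneg_right (Complex.abs_im_le_norm f) (sub_pos.2 hlt).le
        _ = _ := mul_comm _ _
    have := le_of_mul_le_mul_right h1 hf1
    linarith
  · have h1 : (g.im * z.im) * (‖f‖ * ‖f‖) = -(‖g‖ * (‖f‖ - ‖g‖) * (f.im * f.im)) := by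
      calc _ = (g.im * ‖f‖) * (z.im * ‖f‖) := by ring
        _ = _ := by rw [hgim', hwf]; ring
    have h2 : 0 ≤ ‖g‖ * (‖f‖ - ‖g‖) * (f.im * f.im) :=
      mul_nonneg (mul_nonneg (norm_nonneg _) (sub_pos.2 hlt).le) (mul_self_nonneg _)
    by_contra h
    push Not at h
    nlinarith [mul_pos h (mul_pos hf1 hf1)]

/-! ### Orthogonality -/

lemma IsMonicOPS.degree_eq {L : ℂ[X] →ₗ[ℂ] ℂ} {P : ℕ → ℂ[X]} (hP : IsMonicOPS L P) (n : ℕ) :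
    (P n).degree = n := by
  rw [degree_eq_natDegree (hP.monic n).ne_zero, hP.natDegree_eq]

lemma IsMonicOPS.apply_mul_eq_zero {L : ℂ[X] →ₗ[ℂ] ℂ} {P : ℕ → ℂ[X]} (hP : IsMonicOPS L P)
    {n : ℕ} {p : ℂ[X]} (hp : p.degree < n) : L (p * P n) = 0 := by
  induction hm : p.natDegree using Nat.strong_induction_on generalizing p with
  | _ m ih =>
  by_cases h0 : p = 0
  · simp [h0]
  have hdeg : p.degree = m := by rw [degree_eq_natDegree h0, hm]
  have hmn : m < n := by rw [hdeg] at hp; exact_mod_cast hp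
  set d := p - C p.leadingCoeff * P m with hd
  have hlt : d.degree < p.degree := by
    refine degree_sub_lt_left ?_ h0 ?_
    · rw [degree_C_mul (leadingCoeff_ne_zero.2 h0), hdeg, hP.degree_eq]
    · rw [leadingCoeff_mul, leadingCoeff_C, (hP.monic m).leadingCoeff, mul_one]
  have hd0 : L (d * P n) = 0 := by
    by_cases hz : d = 0
    · simp [hz]
    · exact ih d.natDegree (hm ▸ natDegree_lt_natDegree hz hlt) (hlt.trans hp) rfl
  have : p * P n = d * P n + p.leadingCoeff • (P m * P n) := by
    rw [hd, smul_eq_C_mul]; ring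
  rw [this, map_add, map_smul, hd0, hP.orthogonal m n hmn.ne]
  simp

lemma IsMonicOPS.apply_mul_eq_leadingCoeff {L : ℂ[X] →ₗ[ℂ] ℂ} {P : ℕ → ℂ[X]}
    (hP : IsMonicOPS L P) {n : ℕ} {p : ℂ[X]} (hp : p.degree = n) :
    L (p * P n) = p.leadingCoeff * L (P n ^ 2) := by
  have h0 : p ≠ 0 := by rintro rfl; simp at hp
  have hlt : (p - C p.leadingCoeff * P n).degree < p.degree := by
    refine degree_sub_lt_left ?_ h0 ?_
    · rw [degree_C_mul (leadingCoeff_ne_zero.2 h0), hp, hP.degree_eq]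
    · rw [leadingCoeff_mul, leadingCoeff_C, (hP.monic n).leadingCoeff, mul_one]
  have h1 := hP.apply_mul_eq_zero (hp ▸ hlt)
  have : p * P n = (p - C p.leadingCoeff * P n) * P n + p.leadingCoeff • (P n ^ 2) := by
    rw [smul_eq_C_mul]; ring
  rw [this, map_add, map_smul, h1, zero_add, smul_eq_mul]

/-- A polynomial of degree less than `n` that is orthogonal to all such polynomials vanishes. -/
lemma IsMonicOPS.eq_zero_of_orthogonal {L : ℂ[X] →ₗ[ℂ] ℂ} {P : ℕ → ℂ[X]} (hP : IsMonicOPS L P)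
    {n : ℕ} {p : ℂ[X]} (hp : p.degree < n) (h : ∀ q : ℂ[X], q.degree < n → L (p * q) = 0) :
    p = 0 := by
  by_contra h0
  have hd := degree_eq_natDegree h0
  have h1 := hP.apply_mul_eq_leadingCoeff hd
  rw [h _ (by rw [hP.degree_eq]; exact hd ▸ hp)] at h1
  exact mul_ne_zero (leadingCoeff_ne_zero.2 h0) (hP.norm_ne_zero _) h1.symm

/-! ### Reality of the recurrence coefficients -/

lemma PositiveDefiniteFunctional.map_sq_pos {L : ℂ[X] →ₗ[ℂ] ℂ} (hL : PositiveDefiniteFunctional L)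
    {p : ℝ[X]} (hp : p ≠ 0) : 0 < L ((p.map Complex.ofRealHom) ^ 2) := by
  refine hL _ (pow_ne_zero _ ?_) fun x => ?_
  · rwa [Ne, Polynomial.map_eq_zero]
  · have : (p.map Complex.ofRealHom).eval (x : ℂ) = ((p.eval x : ℝ) : ℂ) := by
      rw [← Complex.ofRealHom_eq_coe, eval_map_apply]; rfl
    rw [eval_pow, this, ← Complex.ofReal_pow]
    exact Complex.zero_le_real.2 (sq_nonneg _)

lemma PositiveDefiniteFunctional.im_apply_map {L : ℂ[X] →ₗ[ℂ] ℂ}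
    (hL : PositiveDefiniteFunctional L) (p : ℝ[X]) : (L (p.map Complex.ofRealHom)).im = 0 := by
  have hsq : ∀ q : ℝ[X], (L ((q.map Complex.ofRealHom) ^ 2)).im = 0 := by
    intro q
    by_cases hq : q = 0
    · simp [hq]
    · exact (Complex.pos_iff.1 (hL.map_sq_pos hq)).2.symm
  -- polarization writes `4 p` as a difference of two squares
  have h : (4 : ℂ) • p.map Complex.ofRealHom =
      ((p + 1).map Complex.ofRealHom) ^ 2 - ((p - 1).map Complex.ofRealHom) ^ 2 := by
    simp only [Polynomial.map_add, Polynomial.map_sub, Polynomial.map_one]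
    rw [smul_eq_C_mul, show (C 4 : ℂ[X]) = 4 from rfl]; ring
  have h2 := congrArg (fun t => (L t).im) h
  simp only [map_smul, map_sub, Complex.sub_im, hsq, smul_eq_mul] at h2
  simpa using h2

/-- The OPS of a positive-definite functional in the Nevai class satisfies a three-term recurrence
with real coefficients `b n = c_{n+1}` and `l n = λ_{n+2} > 0`. -/
lemma InNevaiClass.exists_real_recurrence {L : ℂ[X] →ₗ[ℂ] ℂ} {P : ℕ → ℂ[X]} {a c : ℝ}
    (hN : InNevaiClass a c P) (hL : PositiveDefiniteFunctional L) (hP : IsMonicOPS L P) :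
    ∃ b l : ℕ → ℝ, P 0 = 1 ∧ P 1 = X - C (b 0 : ℂ) ∧
      (∀ n, P (n + 2) = (X - C (b (n + 1) : ℂ)) * P (n + 1) - C (l n : ℂ) * P n) ∧
      (∀ n, 0 < l n) ∧ Tendsto b atTop (𝓝 c) ∧ Tendsto l atTop (𝓝 a) := by
  obtain ⟨-, cs, lam, h0, h1, hrec, hlam, hcs⟩ := hN
  have hrec' : ∀ n, X * P (n + 1) =
      P (n + 2) + C (cs (n + 2)) * P (n + 1) + C (lam (n + 2)) * P n :=
    fun n => hrec (n + 1) (by omega)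
  have hpos : ∀ n, (∃ p : ℝ[X], P n = p.map Complex.ofRealHom) → 0 < L (P n ^ 2) := by
    rintro n ⟨p, hp⟩
    rw [hp]
    refine hL.map_sq_pos ?_
    rintro rfl
    exact (hP.monic n).ne_zero (by simp [hp])
  have hlamL : ∀ n, L (P (n + 1) ^ 2) = lam (n + 2) * L (P n ^ 2) := by
    intro n
    have e1 : L (X * P n * P (n + 1)) = L (P (n + 1) ^ 2) := by
      rw [hP.apply_mul_eq_leadingCoeff]
      · rw [(monic_X.mul (hP.monic n)).leadingCoeff, one_mul]
      · rw [degree_mul, degree_X, hP.degree_eq]; push_cast; ring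
    have e2 : X * P n * P (n + 1) = P (n + 2) * P n + cs (n + 2) • (P (n + 1) * P n) +
        lam (n + 2) • (P n ^ 2) := by
      rw [smul_eq_C_mul, smul_eq_C_mul]
      linear_combination P n * hrec' n
    rw [← e1, e2, map_add, map_add, map_smul, map_smul, hP.orthogonal _ _ (by omega),
      hP.orthogonal _ _ (by omega)]
    simp
  have hcsL : ∀ n, L (X * P n ^ 2) = cs (n + 1) * L (P n ^ 2) := by
    intro n
    cases n with
    | zero =>
      have e2 : X * P 0 ^ 2 = P 1 * P 0 + cs 1 • (P 0 ^ 2) := by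
        rw [smul_eq_C_mul, h0, h1]; ring
      rw [e2, map_add, map_smul, hP.orthogonal _ _ (by omega)]
      simp
    | succ n =>
      have e2 : X * P (n + 1) ^ 2 = P (n + 2) * P (n + 1) + cs (n + 2) • (P (n + 1) ^ 2) +
          lam (n + 2) • (P n * P (n + 1)) := by
        rw [smul_eq_C_mul, smul_eq_C_mul]
        linear_combination P (n + 1) * hrec' n
      rw [e2, map_add, map_add, map_smul, map_smul, hP.orthogonal _ _ (by omega),
        hP.orthogonal _ _ (by omega)]
      simp
  have hcsreal : ∀ n, (∃ p : ℝ[X], P n = p.map Complex.ofRealHom) →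
      cs (n + 1) = ((cs (n + 1)).re : ℂ) := by
    intro n hn
    have hp := Complex.pos_iff.1 (hpos n hn)
    have h2 := hcsL n
    obtain ⟨p, hp'⟩ := hn
    have h3 : (L (X * P n ^ 2)).im = 0 := by
      rw [hp']
      have := hL.im_apply_map (X * p ^ 2)
      rwa [Polynomial.map_mul, Polynomial.map_pow, map_X] at this
    rw [h2, Complex.mul_im, ← hp.2] at h3
    have h4 : (cs (n + 1)).im = 0 := by
      have : (cs (n + 1)).im * (L (P n ^ 2)).re = 0 := by linarith
      exact (mul_eq_zero.1 this).resolve_right hp.1.ne'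
    exact Complex.ext (by simp) (by simp [h4])
  have hlampos : ∀ n, (∃ p : ℝ[X], P n = p.map Complex.ofRealHom) →
      (∃ p : ℝ[X], P (n + 1) = p.map Complex.ofRealHom) →
      0 < (lam (n + 2)).re ∧ lam (n + 2) = ((lam (n + 2)).re : ℂ) := by
    intro n hn hn1
    have h2 := Complex.pos_iff.1 (hpos n hn)
    have h3 := Complex.pos_iff.1 (hpos (n + 1) hn1)
    rw [hlamL n, Complex.mul_re, Complex.mul_im, ← h2.2] at h3
    simp only [mul_zero, sub_zero, zero_add] at h3
    have h4 : (lam (n + 2)).im = 0 := (mul_eq_zero.1 h3.2.symm).resolve_right h2.1.ne'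
    exact ⟨pos_of_mul_pos_left h3.1 h2.1.le, Complex.ext (by simp) (by simp [h4])⟩
  have hreal : ∀ n, (∃ p : ℝ[X], P n = p.map Complex.ofRealHom) ∧
      ∃ p : ℝ[X], P (n + 1) = p.map Complex.ofRealHom := by
    intro n
    induction n with
    | zero =>
      have hz : ∃ p : ℝ[X], P 0 = p.map Complex.ofRealHom := ⟨1, by simp [h0]⟩
      exact ⟨hz, X - C (cs 1).re, by rw [h1, hcsreal 0 hz]; simp⟩
    | succ n ih =>
      refine ⟨ih.2, ?_⟩
      have e1 := hcsreal _ ih.2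
      have e2 := (hlampos n ih.1 ih.2).2
      obtain ⟨⟨p, hp⟩, p', hp'⟩ := ih
      refine ⟨(X - C (cs (n + 2)).re) * p' - C (lam (n + 2)).re * p, ?_⟩
      have e3 : P (n + 2) =
          (X - C (cs (n + 2))) * P (n + 1) - C (lam (n + 2)) * P n := by
        linear_combination -hrec' n
      rw [e3, hp, hp', e1, e2]
      simp
  refine ⟨fun n => (cs (n + 1)).re, fun n => (lam (n + 2)).re, h0, ?_, fun n => ?_,
    fun n => (hlampos n (hreal n).1 (hreal n).2).1, ?_, ?_⟩
  · rw [h1, ← hcsreal 0 (hreal 0).1]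
  · rw [← hcsreal (n + 1) (hreal n).2, ← (hlampos n (hreal n).1 (hreal n).2).2]
    linear_combination -hrec' n
  · have := (Complex.continuous_re.tendsto _).comp ((tendsto_add_atTop_iff_nat 1).2 hcs)
    simpa [Function.comp_def] using this
  · have := (Complex.continuous_re.tendsto _).comp ((tendsto_add_atTop_iff_nat 2).2 hlam)
    simpa [Function.comp_def] using this

/-! ### Ratio asymptotics off the real line -/

/-- Off the real line, the solution of the recurrence with the initial values of the OPS does not
vanish, and its successive ratios stay in the half-plane `|Im| ≥ |Im z|` on the side of `z`. -/
lemma recurrence_ratio_im {b l : ℕ → ℝ} (hl : ∀ n, 0 < l n) {z : ℂ} (hz : z.im ≠ 0) {p : ℕ → ℂ}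
    (h0 : p 0 = 1) (h1 : p 1 = z - b 0)
    (hrec : ∀ n, p (n + 2) = (z - b (n + 1)) * p (n + 1) - l n * p n) (n : ℕ) :
    p n ≠ 0 ∧ z.im ^ 2 ≤ (p (n + 1) / p n).im * z.im := by
  induction n with
  | zero => simp [h0, h1, pow_two]
  | succ n ih =>
    obtain ⟨hp, him⟩ := ih
    have hzz : 0 < z.im ^ 2 := by positivity
    have hp1 : p (n + 1) ≠ 0 := by
      intro h
      rw [h, zero_div, Complex.zero_im, zero_mul] at him
      exact absurd him (not_le.2 hzz)
    refine ⟨hp1, ?_⟩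
    set R := p (n + 1) / p n with hR
    have hR0 : R ≠ 0 := div_ne_zero hp1 hp
    have e : p (n + 1 + 1) / p (n + 1) = z - b (n + 1) - l n * R⁻¹ := by
      rw [hrec n, hR]; field_simp
    have hns : 0 < Complex.normSq R := Complex.normSq_pos.2 hR0
    rw [e]
    have e2 : (z - b (n + 1) - l n * R⁻¹).im = z.im + l n * (R.im / Complex.normSq R) := by
      simp [Complex.inv_im]; ring
    rw [e2]
    have : 0 ≤ l n * (R.im * z.im / Complex.normSq R) :=
      mul_nonneg (hl n).le (div_nonneg (hzz.le.trans him) hns.le)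
    have e3 : (z.im + l n * (R.im / Complex.normSq R)) * z.im =
      z.im ^ 2 + l n * (R.im * z.im / Complex.normSq R) := by ring
    linarith

/-- Uniform convergence of the continued-fraction iteration `R ↦ z - b - l / R` to the dominant
characteristic root `f`. In the coordinate `(R - f) / (R - g)` the limit map is multiplication by
`g / f`, a strict contraction. -/
lemma tendstoUniformlyOn_ratio {K : Set ℂ} {R : ℕ → ℂ → ℂ} {f g : ℂ → ℂ} {b l : ℕ → ℝ} {a c δ B : ℝ}
    (hb : Tendsto b atTop (𝓝 c)) (hl : Tendsto l atTop (𝓝 a)) (hδ : 0 < δ) (hB : 0 < B)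
    (hfB : ∀ z ∈ K, ‖f z‖ ≤ B) (hgf : ∀ z ∈ K, ‖g z‖ + δ ≤ ‖f z‖)
    (hsum : ∀ z ∈ K, f z + g z = z - c) (hprod : ∀ z ∈ K, f z * g z = a)
    (hR : ∀ n, ∀ z ∈ K, δ ≤ ‖R n z‖) (hRg : ∀ n, ∀ z ∈ K, δ ≤ ‖R n z - g z‖)
    (hrec : ∀ n, ∀ z ∈ K, R (n + 1) z = z - b (n + 1) - l n / R n z) :
    TendstoUniformlyOn R f atTop K := by
  rcases K.eq_empty_or_nonempty with rfl | ⟨z0, hz0⟩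
  · exact tendstoUniformlyOn_empty
  have hδB : δ ≤ B := by
    have := hgf z0 hz0; have := hfB z0 hz0; have := norm_nonneg (g z0); linarith
  have hq0 : 0 ≤ 1 - δ / B := sub_nonneg.2 ((div_le_one hB).2 hδB)
  have hq1 : 1 - δ / B < 1 := by have := div_pos hδ hB; linarith
  have hgq : ∀ z ∈ K, ‖g z‖ ≤ (1 - δ / B) * ‖f z‖ := by
    intro z hz
    have h1 : δ / B * ‖f z‖ ≤ δ / B * B := mul_le_mul_of_nonneg_left (hfB z hz) (by positivity)
    have h2 : δ / B * B = δ := div_mul_cancel₀ _ hB.ne'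
    have := hgf z hz
    linarith
  set q := 1 - δ / B with hq
  set U := 1 + 2 * B / δ with hU
  have hfg2 : ∀ z ∈ K, ‖f z - g z‖ ≤ 2 * B := by
    intro z hz
    have := norm_sub_le (f z) (g z); have := hgf z hz; have := hfB z hz; linarith
  have hxU : ∀ n, ∀ z ∈ K, ‖R n z - f z‖ / ‖R n z - g z‖ ≤ U := by
    intro n z hz
    have hA := hδ.trans_le (hRg n z hz)
    rw [div_le_iff₀ hA]
    have h1 : ‖R n z - f z‖ ≤ ‖R n z - g z‖ + ‖f z - g z‖ := by
      have := norm_sub_le (R n z - g z) (f z - g z)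
      rwa [sub_sub_sub_cancel_right] at this
    have h2 : 2 * B ≤ 2 * B / δ * ‖R n z - g z‖ := by
      calc 2 * B = 2 * B / δ * δ := by field_simp
        _ ≤ _ := mul_le_mul_of_nonneg_left (hRg n z hz) (by positivity)
    have := hfg2 z hz
    rw [hU]; linarith
  have hU0 : 0 ≤ U := by positivity
  set η : ℕ → ℝ := fun n => (|b (n + 1) - c| + |l n - a| / δ) * (1 + U) / δ with hη
  have hηlim : Tendsto η atTop (𝓝 0) := by
    have h1 : Tendsto (fun n => |b (n + 1) - c|) atTop (𝓝 0) := by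
      have := (((tendsto_add_atTop_iff_nat 1).2 hb).sub_const c).abs
      simpa using this
    have h2 : Tendsto (fun n => |l n - a| / δ) atTop (𝓝 0) := by
      simpa using ((hl.sub_const a).abs).div_const δ
    simpa using ((h1.add h2).mul_const (1 + U)).div_const δ
  have hstep : ∀ n, ∀ z ∈ K, ‖R (n + 1) z - f z‖ / ‖R (n + 1) z - g z‖ ≤
      q * (‖R n z - f z‖ / ‖R n z - g z‖) + η n := by
    intro n z hz
    have hA := hδ.trans_le (hRg n z hz)
    have hA' := hδ.trans_le (hRg (n + 1) z hz)
    have hf0 : 0 < ‖f z‖ := by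
      have := hgf z hz; have := norm_nonneg (g z); linarith
    have hRn : R n z ≠ 0 := norm_pos_iff.1 (hδ.trans_le (hR n z hz))
    set x := ‖R n z - f z‖ / ‖R n z - g z‖ with hx
    have hx0 : 0 ≤ x := by positivity
    set e : ℂ := ((c - b (n + 1) : ℝ) : ℂ) - ((l n - a : ℝ) : ℂ) / R n z with he
    have hen : ‖e‖ ≤ |b (n + 1) - c| + |l n - a| / δ := by
      refine (norm_sub_le _ _).trans ?_
      rw [norm_div, Complex.norm_real, Complex.norm_real, Real.norm_eq_abs, Real.norm_eq_abs,
        abs_sub_comm]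
      have := hR n z hz
      gcongr
    have e1 : R n z * (R (n + 1) z - g z - e) = f z * (R n z - g z) := by
      have h1 : R n z * (R (n + 1) z - g z - e) = (z - c - g z) * R n z - a := by
        rw [hrec n z hz, he]; push_cast; field_simp; ring
      rw [h1, ← hsum z hz, ← hprod z hz]; ring
    have e2 : R n z * (R (n + 1) z - f z - e) = g z * (R n z - f z) := by
      have h1 : R n z * (R (n + 1) z - f z - e) = (z - c - f z) * R n z - a := by
        rw [hrec n z hz, he]; push_cast; field_simp; ring
      rw [h1, ← hsum z hz, ← hprod z hz]; ring
    -- multiplication by `g / f` in the coordinate `(R - f) / (R - g)`, free of denominators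
    have e3 : f z * (R n z - g z) * (R (n + 1) z - f z - e) =
        g z * (R n z - f z) * (R (n + 1) z - g z - e) := by
      rw [← e1, ← e2]; ring
    have e4 := congrArg norm e3
    simp only [norm_mul] at e4
    have e5 : ‖R (n + 1) z - f z - e‖ ≤ q * x * ‖R (n + 1) z - g z - e‖ := by
      have h1 : ‖R n z - f z‖ = x * ‖R n z - g z‖ := (div_mul_cancel₀ _ hA.ne').symm
      have h2 : ‖f z‖ * ‖R n z - g z‖ * ‖R (n + 1) z - f z - e‖ ≤
          ‖f z‖ * ‖R n z - g z‖ * (q * x * ‖R (n + 1) z - g z - e‖) := by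
        rw [e4, h1]
        have := mul_le_mul_of_nonneg_right (hgq z hz)
          (show 0 ≤ x * ‖R n z - g z‖ * ‖R (n + 1) z - g z - e‖ by positivity)
        linarith
      exact le_of_mul_le_mul_left h2 (mul_pos hf0 hA)
    have e6 : ‖R (n + 1) z - f z‖ ≤ q * x * ‖R (n + 1) z - g z‖ + ‖e‖ * (1 + U) := by
      have h1 := norm_add_le (R (n + 1) z - f z - e) e
      rw [sub_add_cancel] at h1
      have h2 := norm_sub_le (R (n + 1) z - g z) e
      have hqx : 0 ≤ q * x := mul_nonneg hq0 hx0
      have hqxU : q * x ≤ U := by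
        have := hxU n z hz
        nlinarith
      have h3 := mul_le_mul_of_nonneg_left h2 hqx
      have h4 := mul_le_mul_of_nonneg_right hqxU (norm_nonneg e)
      linarith
    rw [div_le_iff₀ hA']
    have h7 : ‖e‖ * (1 + U) ≤ η n * ‖R (n + 1) z - g z‖ := by
      calc ‖e‖ * (1 + U) ≤ (|b (n + 1) - c| + |l n - a| / δ) * (1 + U) := by gcongr
        _ = η n * δ := by rw [hη]; field_simp
        _ ≤ _ := mul_le_mul_of_nonneg_left (hRg (n + 1) z hz) (by positivity)
    linarith
  rw [Metric.tendstoUniformlyOn_iff]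
  intro ε hε
  have ht : 0 < min (1 / 2) (ε / (8 * B)) := by positivity
  filter_upwards [eventually_lt_of_forward_contraction hq0 hq1 hxU hstep hηlim ht] with n hn z hz
  have hA := hδ.trans_le (hRg n z hz)
  have hx := hn z hz
  have hx1 := hx.trans_le (min_le_left _ _)
  have hx2 := hx.trans_le (min_le_right _ _)
  rw [lt_div_iff₀ (by positivity)] at hx2
  set x := ‖R n z - f z‖ / ‖R n z - g z‖ with hxdef
  have hx0 : 0 ≤ x := by positivity
  have h1 : ‖R n z - f z‖ = x * ‖R n z - g z‖ := (div_mul_cancel₀ _ hA.ne').symm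
  have h2 : ‖R n z - g z‖ ≤ ‖R n z - f z‖ + 2 * B := by
    have := norm_add_le (R n z - f z) (f z - g z)
    rw [sub_add_sub_cancel] at this
    have := hfg2 z hz
    linarith
  rw [dist_comm, dist_eq_norm]
  nlinarith [mul_le_mul_of_nonneg_left h2 hx0, norm_nonneg (R n z - f z)]

/-- Poincaré's theorem for a second-order recurrence with limiting characteristic roots of
different moduli. -/
lemma tendsto_ratio_of_recurrence {r : ℕ → ℂ} {b l : ℕ → ℝ} {a c : ℝ} {κ f g : ℂ}
    (hr : ∀ n, r n ≠ 0) (hb : Tendsto b atTop (𝓝 c)) (hl : Tendsto l atTop (𝓝 a))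
    (hrec : ∀ n, r (n + 2) = (κ - b (n + 1)) * r (n + 1) - l n * r n)
    (hsum : f + g = κ - c) (hprod : f * g = a) (hlt : ‖g‖ < ‖f‖) :
    Tendsto (fun n => r (n + 1) / r n) atTop (𝓝 f) ∨
      Tendsto (fun n => r (n + 1) / r n) atTop (𝓝 g) := by
  have hne : f - g ≠ 0 := fun h => hlt.ne (by rw [sub_eq_zero.1 h])
  have hD : 0 < ‖f - g‖ := norm_pos_iff.2 hne
  set α : ℕ → ℂ := fun n => r (n + 1) - g * r n with hα
  set β : ℕ → ℂ := fun n => r (n + 1) - f * r n with hβ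
  set e : ℕ → ℂ := fun n => ((c - b (n + 1) : ℝ) : ℂ) * r (n + 1) - ((l n - a : ℝ) : ℂ) * r n
    with he
  have hαs : ∀ n, α (n + 1) = f * α n + e n := by
    intro n
    simp only [hα, he]
    rw [hrec n]; push_cast
    linear_combination (-r (n + 1)) * hsum + r n * hprod
  have hβs : ∀ n, β (n + 1) = g * β n + e n := by
    intro n
    simp only [hβ, he]
    rw [hrec n]; push_cast
    linear_combination (-r (n + 1)) * hsum + r n * hprod
  have hr0 : ∀ n, (f - g) * r n = α n - β n := fun n => by simp only [hα, hβ]; ring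
  have hr1 : ∀ n, (f - g) * r (n + 1) = f * α n - g * β n := fun n => by
    simp only [hα, hβ]; ring
  have hr0n : ∀ n, ‖r n‖ ≤ (‖α n‖ + ‖β n‖) / ‖f - g‖ := by
    intro n
    rw [le_div_iff₀ hD, mul_comm, ← norm_mul, hr0]
    exact norm_sub_le _ _
  have hr1n : ∀ n, ‖r (n + 1)‖ ≤ ‖f‖ * (‖α n‖ + ‖β n‖) / ‖f - g‖ := by
    intro n
    rw [le_div_iff₀ hD, mul_comm, ← norm_mul, hr1]
    refine (norm_sub_le _ _).trans ?_
    rw [norm_mul, norm_mul]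
    nlinarith [norm_nonneg (β n)]
  set ε : ℕ → ℝ := fun n => (|b (n + 1) - c| * ‖f‖ + |l n - a|) / ‖f - g‖ with hε
  have hεlim : Tendsto ε atTop (𝓝 0) := by
    have h1 : Tendsto (fun n => |b (n + 1) - c|) atTop (𝓝 0) := by
      have := (((tendsto_add_atTop_iff_nat 1).2 hb).sub_const c).abs
      simpa using this
    have h2 : Tendsto (fun n => |l n - a|) atTop (𝓝 0) := by
      simpa using (hl.sub_const a).abs
    simpa using ((h1.mul_const ‖f‖).add h2).div_const ‖f - g‖
  have hen : ∀ n, ‖e n‖ ≤ ε n * (‖α n‖ + ‖β n‖) := by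
    intro n
    simp only [he]
    refine (norm_sub_le _ _).trans ?_
    rw [norm_mul, norm_mul, Complex.norm_real, Complex.norm_real, Real.norm_eq_abs,
      Real.norm_eq_abs, abs_sub_comm]
    calc _ ≤ |b (n + 1) - c| * (‖f‖ * (‖α n‖ + ‖β n‖) / ‖f - g‖) +
          |l n - a| * ((‖α n‖ + ‖β n‖) / ‖f - g‖) := by
          gcongr
          · exact hr1n n
          · exact hr0n n
      _ = _ := by rw [hε]; ring
  have habs : ∀ (t : ℂ) (x y e : ℂ), x = t * y + e → |‖x‖ - ‖t‖ * ‖y‖| ≤ ‖e‖ := by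
    intro t x y e h
    rw [← norm_mul]
    refine (abs_norm_sub_norm_le _ _).trans ?_
    rw [h, add_sub_cancel_left]
  have hpos : ∀ n, 0 < ‖α n‖ + ‖β n‖ := by
    intro n
    have h1 := hr0n n
    have h2 := norm_pos_iff.2 (hr n)
    have h3 := h2.trans_le h1
    rw [lt_div_iff₀ hD, zero_mul] at h3
    exact h3
  -- a ratio `x / y → 0` of the two coordinates makes `r (n + 1) / r n` tend to the root `t`
  -- for which `x n = r (n + 1) - t * r n`
  have hconv : ∀ (x y : ℕ → ℂ) (t d : ℂ), (∀ n, x n = r (n + 1) - t * r n) →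
      (∀ n, d * r n = y n - x n) → d ≠ 0 → (∀ᶠ n in atTop, 0 < ‖y n‖) →
      Tendsto (fun n => ‖x n‖ / ‖y n‖) atTop (𝓝 0) →
      Tendsto (fun n => r (n + 1) / r n) atTop (𝓝 t) := by
    intro x y t d hx hd hd0 hy hlim
    have h1 : Tendsto (fun n => x n / y n) atTop (𝓝 0) := by
      rw [tendsto_zero_iff_norm_tendsto_zero]
      simpa only [norm_div] using hlim
    have h2 : Tendsto (fun n => t + d * (x n / y n) / (1 - x n / y n)) atTop (𝓝 t) := by
      have := ((h1.const_mul d).div (h1.const_sub 1) (by simp)).const_add t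
      simpa using this
    refine h2.congr' ?_
    filter_upwards [hy] with n hn
    have hy0 : y n ≠ 0 := norm_pos_iff.1 hn
    have hyx : y n - x n ≠ 0 := hd n ▸ mul_ne_zero hd0 (hr n)
    have e1 : d * (x n / y n) / (1 - x n / y n) = d * x n / (y n - x n) := by
      rw [one_sub_div hy0]; field_simp
    rw [e1, ← hd n, hx n]
    have := hr n
    field_simp
    ring
  rcases dominance_dichotomy (norm_nonneg g) hlt (fun n => norm_nonneg (α n))
    (fun n => norm_nonneg (β n)) hpos
    (fun n => (habs _ _ _ _ (hαs n)).trans (hen n))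
    (fun n => (habs _ _ _ _ (hβs n)).trans (hen n)) hεlim with ⟨h, hp⟩ | ⟨h, hp⟩
  · left
    exact hconv β α f (f - g) (fun n => rfl) hr0 hne hp h
  · right
    exact hconv α β g (g - f) (fun n => rfl) (fun n => by linear_combination -hr0 n)
      (by rwa [← neg_sub, neg_ne_zero]) hp h

/-! ### The Geronimus transformation -/

lemma IsGeronimusTransform.apply {κ : ℂ} {L M : ℂ[X] →ₗ[ℂ] ℂ} (hM : IsGeronimusTransform κ L M)
    (p : ℂ[X]) : M ((X - C κ) * p) = L p := by
  rw [← hM]; rfl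

/-- Writing `q = (X - κ) s + q(κ)` turns orthogonality with respect to a Geronimus transform into
orthogonality to `1` and orthogonality of one degree less with respect to `L`. -/
lemma IsGeronimusTransform.apply_mul_eq_zero {κ : ℂ} {L M : ℂ[X] →ₗ[ℂ] ℂ}
    (hM : IsGeronimusTransform κ L M) {n : ℕ} {p q : ℂ[X]} (hp : M p = 0)
    (hL : ∀ s : ℂ[X], s.degree < n → L (s * p) = 0) (hq : q.degree < (n + 1 : ℕ)) :
    M (p * q) = 0 := by
  have h1 : (X - C κ) * (q /ₘ (X - C κ)) + C (q.eval κ) = q := by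
    rw [add_comm, ← modByMonic_X_sub_C_eq_C_eval]; exact modByMonic_add_div q (X - C κ)
  have h2 : (q /ₘ (X - C κ)).degree < n := by
    by_cases hc : q /ₘ (X - C κ) = 0
    · rw [hc, degree_zero]; exact WithBot.bot_lt_coe n
    · have hq0 : q ≠ 0 := by rintro rfl; simp at hc
      rw [degree_eq_natDegree hc, natDegree_divByMonic _ (monic_X_sub_C κ), natDegree_X_sub_C]
      rw [degree_eq_natDegree hq0] at hq
      have hq' : q.natDegree < n + 1 := by exact_mod_cast hq
      have hd : q.natDegree ≠ 0 := by
        intro hd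
        apply hc
        rw [divByMonic_eq_zero_iff (monic_X_sub_C κ), degree_X_sub_C, degree_eq_natDegree hq0, hd]
        norm_num
      exact_mod_cast (show q.natDegree - 1 < n by omega)
  have h3 : p * q = (X - C κ) * ((q /ₘ (X - C κ)) * p) + q.eval κ • p := by
    rw [smul_eq_C_mul]
    nth_rewrite 1 [← h1]
    ring
  rw [h3, map_add, map_smul, hM.apply, hL _ h2, hp]
  simp

/-- If `M[P_n]` vanished, `P_n` would be `M`-orthogonal to all polynomials of degree at most `n`, in
particular to `G_n`, although it is monic of degree `n`. -/
lemma IsGeronimusTransform.apply_ne_zero {κ : ℂ} {L M : ℂ[X] →ₗ[ℂ] ℂ} {P G : ℕ → ℂ[X]}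
    (hM : IsGeronimusTransform κ L M) (hP : IsMonicOPS L P) (hG : IsMonicOPS M G) (n : ℕ) :
    M (P n) ≠ 0 := by
  intro h
  have h1 : M (P n * G n) = 0 :=
    hM.apply_mul_eq_zero (n := n) h (fun s hs => hP.apply_mul_eq_zero hs)
      (by rw [hG.degree_eq]; exact_mod_cast Nat.lt_succ_self n)
  rw [hG.apply_mul_eq_leadingCoeff (hP.degree_eq n), (hP.monic n).leadingCoeff, one_mul] at h1
  exact hG.norm_ne_zero n h1

/-- The OPS of a Geronimus transform is a quasi-orthogonal combination of two consecutive
polynomials of the original OPS. -/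
lemma IsGeronimusTransform.ops_eq {κ : ℂ} {L M : ℂ[X] →ₗ[ℂ] ℂ} {P G : ℕ → ℂ[X]}
    (hM : IsGeronimusTransform κ L M) (hP : IsMonicOPS L P) (hG : IsMonicOPS M G) (n : ℕ) :
    G (n + 1) = P (n + 1) - C (M (P (n + 1)) / M (P n)) * P n := by
  have hr := hM.apply_ne_zero hP hG n
  set t := M (P (n + 1)) / M (P n) with ht
  set H := P (n + 1) - C t * P n with hH
  have hMH : M H = 0 := by
    rw [hH, ← smul_eq_C_mul, map_sub, map_smul, smul_eq_mul, ht, div_mul_cancel₀ _ hr, sub_self]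
  have hLH : ∀ s : ℂ[X], s.degree < n → L (s * H) = 0 := by
    intro s hs
    have e : s * H = s * P (n + 1) - t • (s * P n) := by rw [hH, smul_eq_C_mul]; ring
    rw [e, map_sub, map_smul, hP.apply_mul_eq_zero hs,
      hP.apply_mul_eq_zero (hs.trans (by exact_mod_cast Nat.lt_succ_self n))]
    simp
  have hdeg : (G (n + 1) - H).degree < (n + 1 : ℕ) := by
    have e : G (n + 1) - H = (G (n + 1) - P (n + 1)) + C t * P n := by rw [hH]; ring
    rw [e]
    refine (degree_add_le _ _).trans_lt (max_lt ?_ ?_)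
    · have := degree_sub_lt_left (p := G (n + 1)) (q := P (n + 1))
        (by rw [hG.degree_eq, hP.degree_eq]) (hG.monic _).ne_zero
        (by rw [(hG.monic _).leadingCoeff, (hP.monic _).leadingCoeff])
      rwa [hG.degree_eq] at this
    · rw [← smul_eq_C_mul]
      refine (degree_smul_le _ _).trans_lt ?_
      rw [hP.degree_eq]
      exact_mod_cast Nat.lt_succ_self n
  refine sub_eq_zero.1 (hG.eq_zero_of_orthogonal hdeg fun q hq => ?_)
  rw [sub_mul, map_sub, hM.apply_mul_eq_zero hMH hLH hq, mul_comm, hG.apply_mul_eq_zero hq, sub_zero]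

/-! ### Ratio asymptotics of the transformed system -/

theorem mainTheorem6 (L M : ℂ[X] →ₗ[ℂ] ℂ) (P G : ℕ → ℂ[X]) (κ : ℂ) (a c : ℝ)
    (hL : PositiveDefiniteFunctional L) (hP : IsMonicOPS L P)
    (hκ : κ.im ≠ 0) (hM : IsGeronimusTransform κ L M) (hG : IsMonicOPS M G)
    (hN : InNevaiClass a c P) :
    ∀ K : Set ℂ, IsCompact K → K ⊆ (Set.range (fun x : ℝ => (x : ℂ)) ∪ {κ})ᶜ →
      (∀ᶠ n in atTop, ∀ z ∈ K, (G n).eval z ≠ 0) ∧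
      TendstoUniformlyOn (fun n z => (G (n + 1)).eval z / (G n).eval z)
        (nevaiRatioLimit a c) atTop K := by
  intro K hK hKsub
  rcases K.eq_empty_or_nonempty with rfl | hKne
  · exact ⟨by simp, tendstoUniformlyOn_empty⟩
  have ha : 0 ≤ a := hN.1
  obtain ⟨b, l, hP0, hP1, hrec, hlpos, hb, hl⟩ := hN.exists_real_recurrence hL hP
  have him : ∀ z ∈ K, z.im ≠ 0 := fun z hz h =>
    hKsub hz (Or.inl ⟨z.re, Complex.ext (by simp) (by simp [h])⟩)
  have hzκ : ∀ z ∈ K, z ≠ κ := fun z hz h => hKsub hz (Or.inr h)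
  -- uniform constants on `K`: `δ ≤ |Im z|`, `d ≤ |z - κ|` and `|f|, |f(κ)| ≤ B`
  obtain ⟨δ, hδ, hδK⟩ : ∃ δ > 0, ∀ z ∈ K, δ ≤ |z.im| := by
    obtain ⟨z, hz, hmin⟩ := hK.exists_isMinOn hKne
      (Complex.continuous_im.abs.continuousOn)
    exact ⟨|z.im|, abs_pos.2 (him z hz), fun y hy => hmin hy⟩
  obtain ⟨d, hd, hdK⟩ : ∃ d > 0, ∀ z ∈ K, d ≤ ‖z - κ‖ := by
    obtain ⟨z, hz, hmin⟩ := hK.exists_isMinOn hKne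
      ((continuous_id.sub (continuous_const (y := κ))).norm.continuousOn)
    exact ⟨‖z - κ‖, norm_pos_iff.2 (sub_ne_zero.2 (hzκ z hz)), fun y hy => hmin hy⟩
  set f := nevaiRatioLimit a c with hf
  set g : ℂ → ℂ := fun z => z - c - f z with hg
  have hroots : ∀ z : ℂ, z.im ≠ 0 → f z * g z = a ∧ ‖g z‖ + |z.im| ≤ ‖f z‖ ∧
      (g z).im * z.im ≤ 0 := fun z hz => nevaiRatioLimit_roots ha hz
  have hsum : ∀ z, f z + g z = z - c := fun z => by simp [hg]
  have hfle : ∀ z : ℂ, z.im ≠ 0 → ‖f z‖ ≤ ‖z‖ + |c| + a + 1 := by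
    intro z hz
    obtain ⟨h1, h2, -⟩ := hroots z hz
    have h3 : ‖f z‖ * ‖g z‖ = a := by
      rw [← norm_mul, h1, Complex.norm_real, Real.norm_of_nonneg ha]
    have h4 : ‖g z‖ ≤ a + 1 := by
      have := abs_nonneg z.im
      nlinarith [norm_nonneg (g z)]
    have h5 : ‖f z‖ ≤ ‖z - c‖ + ‖g z‖ := by
      rw [← hsum z]
      have := norm_sub_le (f z + g z) (g z)
      rwa [add_sub_cancel_right] at this
    have h6 := norm_sub_le z c
    rw [Complex.norm_real, Real.norm_eq_abs] at h6
    linarith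
  obtain ⟨B, hB, hfB, hfκ⟩ : ∃ B > 0, (∀ z ∈ K, ‖f z‖ ≤ B) ∧ ‖f κ‖ ≤ B := by
    obtain ⟨C0, hC0⟩ := hK.isBounded.exists_norm_le
    refine ⟨|C0| + ‖κ‖ + |c| + a + 1, by positivity, fun z hz => ?_, ?_⟩
    · have := hfle z (him z hz); have := hC0 z hz; have := le_abs_self C0
      have := norm_nonneg κ; linarith
    · have := hfle κ hκ; have := abs_nonneg C0; linarith
  set R : ℕ → ℂ → ℂ := fun n z => (P (n + 1)).eval z / (P n).eval z with hRdef
  have hRim : ∀ n, ∀ z ∈ K, (P n).eval z ≠ 0 ∧ z.im ^ 2 ≤ (R n z).im * z.im := fun n z hz =>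
    recurrence_ratio_im (b := b) hlpos (him z hz) (p := fun n => (P n).eval z) (by simp [hP0])
      (by simp [hP1]) (fun n => by simp [hrec n]) n
  have hge : ∀ (x z : ℂ), z ∈ K → z.im ^ 2 ≤ x.im * z.im → δ ≤ ‖x‖ := by
    intro x z hz h
    refine (hδK z hz).trans (le_trans ?_ (Complex.abs_im_le_norm x))
    have h1 : |z.im| * |z.im| ≤ |x.im| * |z.im| := by
      rw [← abs_mul, ← abs_mul, abs_mul_self, ← pow_two]
      exact h.trans (le_abs_self _)
    exact le_of_mul_le_mul_right h1 (abs_pos.2 (him z hz))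
  have hRlim : TendstoUniformlyOn R f atTop K := by
    refine tendstoUniformlyOn_ratio (g := g) hb hl hδ hB hfB (fun z hz => ?_) (fun z _ => hsum z)
      (fun z hz => (hroots z (him z hz)).1) (fun n z hz => hge _ z hz (hRim n z hz).2)
      (fun n z hz => hge _ z hz ?_) (fun n z hz => ?_)
    · have := (hroots z (him z hz)).2.1; have := hδK z hz; linarith
    · have h1 := (hroots z (him z hz)).2.2
      have h2 := (hRim n z hz).2
      rw [Complex.sub_im]; linarith
    · have h1 := (hRim n z hz).1
      have h2 := (hRim (n + 1) z hz).1
      simp only [hRdef]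
      rw [hrec n]
      simp only [eval_sub, eval_mul, eval_X, eval_C]
      field_simp
  set r : ℕ → ℂ := fun n => M (P n) with hr
  have hr0 : ∀ n, r n ≠ 0 := hM.apply_ne_zero hP hG
  have hrrec : ∀ n, r (n + 2) = (κ - b (n + 1)) * r (n + 1) - l n * r n := by
    intro n
    have h1 : L (P (n + 1)) = 0 := by
      have := hP.apply_mul_eq_zero (n := n + 1) (p := 1)
        (by rw [degree_one]; exact_mod_cast Nat.succ_pos n)
      rwa [one_mul] at this
    have e : P (n + 2) = (X - C κ) * P (n + 1) + (κ - b (n + 1)) • P (n + 1) - (l n : ℂ) • P n := by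
      rw [hrec n, smul_eq_C_mul, smul_eq_C_mul]; simp only [C_sub]; ring
    simp only [hr]
    rw [e, map_sub, map_add, map_smul, map_smul, hM.apply, h1, zero_add, smul_eq_mul, smul_eq_mul]
  obtain ⟨hκ1, hκ2, -⟩ := hroots κ hκ
  have hκlt : ‖g κ‖ < ‖f κ‖ := by have := abs_pos.2 hκ; linarith
  set ρ : ℕ → ℂ := fun n => r (n + 1) / r n with hρ
  have hGeval : ∀ n, ∀ z ∈ K, (G (n + 1)).eval z = (P n).eval z * (R n z - ρ n) := by
    intro n z hz
    have h1 := (hRim n z hz).1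
    rw [hM.ops_eq hP hG n]
    simp only [eval_sub, eval_mul, eval_C, hRdef, hρ, hr]
    field_simp
  -- both possible limits of `ρ` are uniformly separated from `f` on `K`
  obtain ⟨ρ₀, hρlim, hm⟩ : ∃ ρ₀, Tendsto ρ atTop (𝓝 ρ₀) ∧
      ∀ z ∈ K, δ * d / (2 * B) ≤ ‖f z - ρ₀‖ := by
    have hprod : ∀ z ∈ K, δ * d ≤ ‖f z - f κ‖ * ‖f z - g κ‖ := by
      intro z hz
      obtain ⟨h1, h2, -⟩ := hroots z (him z hz)
      have e : (f z - f κ) * (f z - g κ) = f z * (z - κ) := by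
        linear_combination hκ1 - h1 - f z * hsum κ + f z * hsum z
      rw [← norm_mul, e, norm_mul]
      have h3 : δ ≤ ‖f z‖ := by have := hδK z hz; have := norm_nonneg (g z); linarith
      exact mul_le_mul h3 (hdK z hz) hd.le (norm_nonneg _)
    rcases tendsto_ratio_of_recurrence hr0 hb hl hrrec (hsum κ) hκ1 hκlt with h | h
    · refine ⟨f κ, h, fun z hz => ?_⟩
      rw [div_le_iff₀ (by positivity)]
      refine (hprod z hz).trans (mul_le_mul_of_nonneg_left ?_ (norm_nonneg _))
      have := norm_sub_le (f z) (g κ); have := hfB z hz; linarith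
    · refine ⟨g κ, h, fun z hz => ?_⟩
      rw [div_le_iff₀ (by positivity), mul_comm ‖_‖]
      refine (hprod z hz).trans (mul_le_mul_of_nonneg_right ?_ (norm_nonneg _))
      have := norm_sub_le (f z) (f κ); have := hfB z hz; linarith
  set m := δ * d / (2 * B) with hmdef
  have hm0 : 0 < m := by positivity
  rw [Metric.tendstoUniformlyOn_iff] at hRlim
  have hclose : ∀ t > 0, ∀ᶠ n in atTop, (∀ z ∈ K, ‖R n z - f z‖ < t) ∧ ‖ρ n - ρ₀‖ < t := by
    intro t ht
    filter_upwards [hRlim t ht, Metric.tendsto_nhds.1 hρlim t ht] with n h1 h2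
    exact ⟨fun z hz => by rw [← dist_eq_norm, dist_comm]; exact h1 z hz, by rwa [← dist_eq_norm]⟩
  have hlow : ∀ n, ∀ z ∈ K, ‖R n z - f z‖ < m / 4 → ‖ρ n - ρ₀‖ < m / 4 →
      m / 2 ≤ ‖R n z - ρ n‖ := by
    intro n z hz h1 h2
    have h3 : ‖f z - ρ₀‖ ≤ ‖R n z - ρ n‖ + ‖R n z - f z‖ + ‖ρ n - ρ₀‖ := by
      have e : f z - ρ₀ = (R n z - ρ n) - (R n z - f z) + (ρ n - ρ₀) := by ring
      rw [e]
      exact (norm_add_le _ _).trans (by gcongr; exact norm_sub_le _ _)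
    have := hm z hz
    linarith
  constructor
  · rw [← map_add_atTop_eq_nat 1, eventually_map]
    filter_upwards [hclose (m / 4) (by positivity)] with n hn z hz
    rw [hGeval n z hz]
    refine mul_ne_zero (hRim n z hz).1 (norm_pos_iff.1 ?_)
    have := hlow n z hz (hn.1 z hz) hn.2
    linarith
  · rw [Metric.tendstoUniformlyOn_iff]
    intro ε hε
    rw [← map_add_atTop_eq_nat 1, eventually_map]
    -- if `R` and `ρ` are within `t` of their limits at `n` and `n + 1`, the quotient is within
    -- `t * (1 + 8 * (B + 1) / m)` of `f`
    set t := min (min (m / 4) 1) (ε / (2 * (1 + 8 * (B + 1) / m))) with htdef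
    have ht : 0 < t := by positivity
    have ht1 : t ≤ m / 4 := (min_le_left _ _).trans (min_le_left _ _)
    have ht2 : t ≤ 1 := (min_le_left _ _).trans (min_le_right _ _)
    have ht3 : t * (2 * (1 + 8 * (B + 1) / m)) ≤ ε :=
      (le_div_iff₀ (by positivity)).1 (min_le_right _ _)
    filter_upwards [hclose t ht, (tendsto_add_atTop_nat 1).eventually (hclose t ht)] with n hn hn'
      z hz
    have hlo := hlow n z hz ((hn.1 z hz).trans_le ht1) (hn.2.trans_le ht1)
    have hne : R n z - ρ n ≠ 0 := norm_pos_iff.1 (lt_of_lt_of_le (by positivity) hlo)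
    have e : (G (n + 1 + 1)).eval z / (G (n + 1)).eval z - f z = (R n z - f z) +
        R n z * ((R (n + 1) z - f z) - (R n z - f z) - ((ρ (n + 1) - ρ₀) - (ρ n - ρ₀))) /
          (R n z - ρ n) := by
      have e1 : (P (n + 1)).eval z = (P n).eval z * R n z := by
        simp only [hRdef]; field_simp [(hRim n z hz).1]
      have hp := (hRim n z hz).1
      rw [hGeval (n + 1) z hz, hGeval n z hz, e1]
      field_simp
      ring
    rw [dist_comm, dist_eq_norm, e]
    have hRB : ‖R n z‖ ≤ B + 1 := by
      have h1 := norm_add_le (R n z - f z) (f z)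
      rw [sub_add_cancel] at h1
      have := hfB z hz; have := hn.1 z hz; linarith
    have hnum : ‖(R (n + 1) z - f z) - (R n z - f z) - ((ρ (n + 1) - ρ₀) - (ρ n - ρ₀))‖ ≤ 4 * t := by
      have h1 := norm_sub_le ((R (n + 1) z - f z) - (R n z - f z)) ((ρ (n + 1) - ρ₀) - (ρ n - ρ₀))
      have h2 := norm_sub_le (R (n + 1) z - f z) (R n z - f z)
      have h3 := norm_sub_le (ρ (n + 1) - ρ₀) (ρ n - ρ₀)
      have := hn.1 z hz; have := hn'.1 z hz; have := hn.2; have := hn'.2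
      linarith
    have hfrac : ‖R n z * ((R (n + 1) z - f z) - (R n z - f z) -
        ((ρ (n + 1) - ρ₀) - (ρ n - ρ₀))) / (R n z - ρ n)‖ ≤ (B + 1) * (4 * t) / (m / 2) := by
      rw [norm_div, norm_mul]
      gcongr
    have e5 : (B + 1) * (4 * t) / (m / 2) = t * (8 * (B + 1) / m) := by field_simp; ring
    have h9 := norm_add_le (R n z - f z) (R n z * ((R (n + 1) z - f z) - (R n z - f z) -
        ((ρ (n + 1) - ρ₀) - (ρ n - ρ₀))) / (R n z - ρ n))
    have h10 : 0 < t * (1 + 8 * (B + 1) / m) := by positivity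
    have := hn.1 z hz
    rw [e5] at hfrac
    linarith
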